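/- Let $A\in\mathbb R^{N\times N}$ be Hurwitz, $B\in\mathbb R^{N\times q}$, $C\in\mathbb R^{p\times N}$, let $u$ be square-integrable on $[0,\infty)$, let $x_0\in\mathbb R^N$ be arbitrary, and let $$\dot x=Ax+Bu,\qquad x(0)=x_0,\qquad y=Cx.$$ Let $Q$ be the observability Gramian, $A^TQ+QA=-C^TC$, and let $U$ be an exact Cholesky factor of it, $Q=U^TU$. Write $\|f\|_{L^2}=\bigl(\int_0^\infty\|f(t)\|^2dt\bigr)^{1/2}$ with the Euclidean norm. The Hankel singular values $\sigma_1\ge\dots\ge\sigma_N\ge0$ of a system $(A,\mathcal B,C)$ are the square roots of the eigenvalues of $PQ$, where $AP+PA^T=-\mathcal B\mathcal B^T$. Balanced truncation of order $n$ (with $\sigma_n>\sigma_{n+1}$) of $(A,\mathcal B,C)$ takes an invertible $T$ such that $(T^{-1}AT,T^{-1}\mathcal B,CT)$ is balanced, i.e. both of its Gramians are diagonal with diagonal entries $\sigma_1,\dots,\sigma_N$ (for $\sigma_i=0$ it is only required that the product of the two $i$-th diagonal entries be $0$), and uses as bases $V$, the first $n$ columns of $T$, and $W$, where $W^T$ consists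 of the first $n$ rows of $T^{-1}$. For a Hurwitz matrix $\hat A\in\mathbb R^{n\times n}$ and matrices $\hat C\in\mathbb R^{p\times n}$, $W\in\mathbb R^{N\times n}$ let $Q_m,\hat Q$ be the solutions of $$A^TQ_m+Q_m\hat A=C^T\hat C,\qquad \hat A^T\hat Q+\hat Q\hat A=-\hat C^T\hat C,$$ and put $$\Delta_{x_0}=\sqrt{\|Ux_0\|^2+2x_0^TQ_mW^Tx_0+x_0^TW\hat QW^Tx_0}.$$ (a) (BT-aug.) Let $X_0\in\mathbb R^{N\times N_0}$, let $V,W$ be obtained by balanced truncation of order $n$ of the augmented system $(A,[B,X_0],C)$, let $\hat A=W^TAV$ be Hurwitz and $\hat C=CV$, and let $\dot{\hat x}=\hat A\hat x+W^TBu$, $\hat x(0)=W^Tx_0$, $\hat y=\hat C\hat x$. Then $y-\hat y$ is square-integrable and $$\|y-\hat y\|_{L^2}\le\alpha_{\mathrm{aug}}\|u\|_{L^2}+\Delta_{x_0},\qquad \alpha_{\mathrm{aug}}=2\sum_{i=n+1}^N\sigma_i,$$ where $\sigma_i$ are the Hankel singular values of $(A,[B,X_0],C)$. (b) (Splitted approach.)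 Let $V_u,W_u$ be obtained by balanced truncation of order $k$ of $(A,B,C)$, with Hankel singular values $\sigma_i$, and let the uncontrolled part be reduced by any model $(\hat A,\hat C,W)$ with $\hat A$ Hurwitz (in particular $\hat A=W^TAV$, $\hat C=CV$ with bases $V,W$ obtained by balanced truncation, IRKA or ISRK for $(A,X_0,C)$). Let $$\dot{\hat z}=\hat A\hat z,\quad \hat z(0)=W^Tx_0,\qquad \dot{\hat x}_u=W_u^TAV_u\hat x_u+W_u^TBu,\quad \hat x_u(0)=0,\qquad \hat y=\hat C\hat z+CV_u\hat x_u.$$ Then $y-\hat y$ is square-integrable and $$\|y-\hat y\|_{L^2}\le\alpha_{\mathrm{spl}}\|u\|_{L^2}+\Delta_{x_0},\qquad \alpha_{\mathrm{spl}}=2\sum_{i=k+1}^N\sigma_i.$$ -/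

import Mathlib

open MeasureTheory Matrix

/-- A real square matrix is Hurwitz if all its complex eigenvalues have negative real part. -/
def IsHurwitz {ι : Type*} [Fintype ι] [DecidableEq ι] (A : Matrix ι ι ℝ) : Prop :=
  ∀ μ ∈ spectrum ℂ (A.map (algebraMap ℝ ℂ)), μ.re < 0

/-- `Q` solves the observability Lyapunov equation `Aᵀ Q + Q A = -Cᵀ C`. For Hurwitz `A` the
solution is unique, and it is the observability Gramian. -/
def IsObservabilityGramian {ι o : Type*} [Fintype ι] [Fintype o]
    (A : Matrix ι ι ℝ) (C : Matrix o ι ℝ) (Q : Matrix ι ι ℝ) : Prop :=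
  Aᵀ * Q + Q * A = -(Cᵀ * C)

/-- `P` solves the controllability Lyapunov equation `A P + P Aᵀ = -B Bᵀ`. For Hurwitz `A` the
solution is unique, and it is the controllability Gramian. -/
def IsControllabilityGramian {ι κ : Type*} [Fintype ι] [Fintype κ]
    (A : Matrix ι ι ℝ) (B : Matrix ι κ ℝ) (P : Matrix ι ι ℝ) : Prop :=
  A * P + P * Aᵀ = -(B * Bᵀ)

/-- `σ 0 ≥ σ 1 ≥ … ≥ 0` are the Hankel singular values of `(A, B, C)`: the numbers `(σ i) ^ 2` are
the eigenvalues of `P Q`, counted with algebraic multiplicity. -/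
def IsHankelSingularValues {N : ℕ} {κ o : Type*} [Fintype κ] [Fintype o]
    (A : Matrix (Fin N) (Fin N) ℝ) (B : Matrix (Fin N) κ ℝ) (C : Matrix o (Fin N) ℝ)
    (σ : Fin N → ℝ) : Prop :=
  Antitone σ ∧ (∀ i, 0 ≤ σ i) ∧
    ∃ P Q : Matrix (Fin N) (Fin N) ℝ, IsControllabilityGramian A B P ∧
      IsObservabilityGramian A C Q ∧
      (P * Q).charpoly = ∏ i, (Polynomial.X - Polynomial.C (σ i ^ 2))

/-- The state transformation `x = T x'` brings `(A, B, C)` into balanced form: the Gramians of the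
realization `(T⁻¹ A T, T⁻¹ B, C T)` are both diagonal, with the Hankel singular values `σ i` as
diagonal entries. A state whose Hankel singular value is zero may be uncontrollable but observable,
or the reverse; there only the product of the two diagonal entries is required to vanish, because a
system that is not minimal need not have a realization with two equal Gramians. -/
def IsBalancingTransformation {N : ℕ} {κ o : Type*} [Fintype κ] [Fintype o]
    (A : Matrix (Fin N) (Fin N) ℝ) (B : Matrix (Fin N) κ ℝ) (C : Matrix o (Fin N) ℝ)
    (σ : Fin N → ℝ) (T : Matrix (Fin N) (Fin N) ℝ) : Prop :=
  IsUnit T.det ∧ ∃ pc qo : Fin N → ℝ,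
    IsControllabilityGramian (T⁻¹ * A * T) (T⁻¹ * B) (Matrix.diagonal pc) ∧
    IsObservabilityGramian (T⁻¹ * A * T) (C * T) (Matrix.diagonal qo) ∧
    ∀ i, (σ i ≠ 0 → pc i = σ i ∧ qo i = σ i) ∧ (σ i = 0 → pc i * qo i = 0)

/-- `V, W` are reduction bases of order `n` obtained by balanced truncation of `(A, B, C)` with
Hankel singular values `σ`: the first `n` states of a balanced form are kept, where the last kept
singular value is larger than the first truncated one. Here `V` consists of the first `n` columns
of `T`, and `Wᵀ` of the first `n` rows of `T⁻¹`. -/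
def IsBalancedTruncation {N n : ℕ} {κ o : Type*} [Fintype κ] [Fintype o]
    (A : Matrix (Fin N) (Fin N) ℝ) (B : Matrix (Fin N) κ ℝ) (C : Matrix o (Fin N) ℝ)
    (σ : Fin N → ℝ) (V W : Matrix (Fin N) (Fin n) ℝ) : Prop :=
  IsHankelSingularValues A B C σ ∧
  (∀ i j : Fin N, (i : ℕ) < n → n ≤ (j : ℕ) → σ j < σ i) ∧
  ∃ (h : n ≤ N) (T : Matrix (Fin N) (Fin N) ℝ), IsBalancingTransformation A B C σ T ∧
    V = T.submatrix id (Fin.castLE h) ∧ Wᵀ = T⁻¹.submatrix (Fin.castLE h) id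

/-- Twice the sum of the truncated Hankel singular values for a reduced model of order `n`. -/
noncomputable def truncationBound {N : ℕ} (σ : Fin N → ℝ) (n : ℕ) : ℝ :=
  2 * ∑ i ∈ Finset.univ.filter (fun i : Fin N => n ≤ (i : ℕ)), σ i

/-- `x` is the (Carathéodory) solution on `[0, ∞)` of `x'(t) = A x(t) + f(t)`, `x(0) = x₀`. -/
def IsSolution {ι : Type*} [Fintype ι] (A : Matrix ι ι ℝ) (f : ℝ → ι → ℝ) (x₀ : ι → ℝ)
    (x : ℝ → ι → ℝ) : Prop :=
  ContinuousOn x (Set.Ici 0) ∧ ∀ t, 0 ≤ t → x t = x₀ + ∫ s in (0 : ℝ)..t, (A *ᵥ x s + f s)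

/-- The forcing term `t ↦ B u(t)` of a controlled system. -/
def forcing {ι κ : Type*} [Fintype κ] (B : Matrix ι κ ℝ) (u : ℝ → EuclideanSpace ℝ κ) :
    ℝ → ι → ℝ :=
  fun t => B *ᵥ (u t).ofLp

/-- The output `t ↦ C x(t)`, with values in a Euclidean space. -/
def output {ι o : Type*} [Fintype ι] (C : Matrix o ι ℝ) (x : ℝ → ι → ℝ) :
    ℝ → EuclideanSpace ℝ o :=
  fun t => WithLp.toLp 2 (C *ᵥ x t)

/-- Square-integrability in time `t ∈ [0, ∞)`. -/
def SquareIntegrable {E : Type*} [NormedAddCommGroup E] (f : ℝ → E) : Prop :=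
  MemLp f 2 (volume.restrict (Set.Ici 0))

/-- The `L²`-norm on `[0, ∞)` of a square-integrable function. -/
noncomputable def l2Norm {E : Type*} [NormedAddCommGroup E] (f : ℝ → E) : ℝ :=
  Real.sqrt (∫ t in Set.Ici (0 : ℝ), ‖f t‖ ^ 2)

/-- The error estimator
`Δ = √(‖U x₀‖² + 2 x₀ᵀ Qm Wᵀ x₀ + x₀ᵀ W Qr Wᵀ x₀)` for the initial value `x₀`. -/
noncomputable def errorEstimator {N n m : ℕ} (U : Matrix (Fin m) (Fin N) ℝ)
    (Qm : Matrix (Fin N) (Fin n) ℝ) (Qr : Matrix (Fin n) (Fin n) ℝ)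
    (W : Matrix (Fin N) (Fin n) ℝ) (x₀ : Fin N → ℝ) : ℝ :=
  Real.sqrt (‖WithLp.toLp 2 (U *ᵥ x₀)‖ ^ 2 + 2 * (x₀ ⬝ᵥ (Qm * Wᵀ) *ᵥ x₀)
    + x₀ ⬝ᵥ (W * Qr * Wᵀ) *ᵥ x₀)

/-! By linearity the state splits into the free response to `x₀` with zero input and the forced
response to `u` with zero initial value, and the reduced models split in the same way. The triangle
inequality in `L²` leaves two independent estimates.

Free part (`IsHurwitz.output_sub_autonomous`): the block matrix with blocks `Q`, `Qm`, `Qr` is the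
observability Gramian of the error system, so its quadratic form decreases along trajectories at the
rate of the squared output error. Both systems are Hurwitz, hence the form tends to zero and its
initial value is the whole error energy. That value is the square of the estimator.

Forced part (`IsBalancedTruncation.l2Norm_output_sub_le`): in balanced coordinates the truncated
states are removed one at a time. If `x` and `y` solve the systems before and after removing state
`i₀`, the storage function `∑ qᵢ (xᵢ - yᵢ)² + p_{i₀} q_{i₀} ∑ (xᵢ + yᵢ)² / pᵢ` satisfies a
dissipation inequality (`truncation_dissipation`) with supply rate `4 p_{i₀} q_{i₀} ‖u‖² - ‖Cx -
Cy‖²`. Each removal therefore costs at most `2 σ_{i₀} ‖u‖`, and no stability of the intermediate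
systems is needed. States with `pᵢ = 0` are unreachable from zero and are dropped at no cost.

In the augmented case the control is padded by zeros in the `X₀` channels. -/

/-- `f` is an antiderivative of `f'` on `[0, ∞)` in the sense of Carathéodory. -/
structure IsPrimitive (f f' : ℝ → ℝ) : Prop where
  intervalIntegrable : ∀ T, 0 ≤ T → IntervalIntegrable f' volume 0 T
  eq_add_integral : ∀ T, 0 ≤ T → f T = f 0 + ∫ s in (0 : ℝ)..T, f' s

/-! ### Calculus of absolutely continuous scalar functions on the half-line. -/

namespace IsPrimitive

theorem zero : IsPrimitive (fun _ => 0) (fun _ => 0) :=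
  ⟨fun _ _ => by simp, fun _ _ => by simp⟩

theorem add {f f' g g' : ℝ → ℝ} (hf : IsPrimitive f f') (hg : IsPrimitive g g') :
    IsPrimitive (fun t => f t + g t) (fun t => f' t + g' t) := by
  refine ⟨fun T hT => (hf.1 T hT).add (hg.1 T hT), fun T hT => ?_⟩
  rw [intervalIntegral.integral_add (hf.1 T hT) (hg.1 T hT), hf.2 T hT, hg.2 T hT]
  ring

theorem const_mul {f f' : ℝ → ℝ} (c : ℝ) (hf : IsPrimitive f f') :
    IsPrimitive (fun t => c * f t) (fun t => c * f' t) := by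
  refine ⟨fun T hT => (hf.1 T hT).const_mul c, fun T hT => ?_⟩
  rw [intervalIntegral.integral_const_mul, hf.2 T hT]
  ring

theorem sub {f f' g g' : ℝ → ℝ} (hf : IsPrimitive f f') (hg : IsPrimitive g g') :
    IsPrimitive (fun t => f t - g t) (fun t => f' t - g' t) := by
  simpa [sub_eq_add_neg] using hf.add (hg.const_mul (-1))

theorem sum {ι : Type*} (s : Finset ι) {f f' : ι → ℝ → ℝ} (h : ∀ i ∈ s, IsPrimitive (f i) (f' i)) :
    IsPrimitive (fun t => ∑ i ∈ s, f i t) (fun t => ∑ i ∈ s, f' i t) := by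
  classical
  induction s using Finset.induction_on with
  | empty => simpa using zero
  | insert i s hi ih =>
    simp only [Finset.sum_insert hi]
    exact (h i (by simp)).add (ih fun j hj => h j (by simp [hj]))

theorem continuousOn {f f' : ℝ → ℝ} (hf : IsPrimitive f f') : ContinuousOn f (Set.Ici 0) := by
  intro t ht
  have ht : (0 : ℝ) ≤ t := ht
  have h1 := intervalIntegral.continuousOn_primitive_interval' (hf.1 (t + 1) (by linarith))
    (a := 0) (by simp)
  rw [Set.uIcc_of_le (by linarith)] at h1
  have h2 : ContinuousOn f (Set.Icc 0 (t + 1)) :=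
    (continuousOn_const.add h1).congr fun s hs => hf.2 s hs.1
  refine (h2 t ⟨ht, by linarith⟩).mono_of_mem_nhdsWithin ?_
  rw [← Set.Ici_inter_Iic]
  exact Filter.inter_mem self_mem_nhdsWithin (mem_nhdsWithin_of_mem_nhds (Iic_mem_nhds (by linarith)))

theorem congr {f f' g g' : ℝ → ℝ} (hf : IsPrimitive f f') (h : ∀ t, 0 ≤ t → g t = f t)
    (h' : ∀ t, 0 ≤ t → g' t = f' t) : IsPrimitive g g' := by
  have key : ∀ T, 0 ≤ T → Set.EqOn f' g' (Set.uIcc 0 T) := by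
    intro T hT s hs
    rw [Set.uIcc_of_le hT] at hs
    exact (h' s hs.1).symm
  refine ⟨fun T hT => ?_, fun T hT => ?_⟩
  · exact (hf.1 T hT).congr fun s hs => key T hT (Set.uIoc_subset_uIcc hs)
  · rw [h T hT, h 0 le_rfl, hf.2 T hT, intervalIntegral.integral_congr (key T hT)]

/-- An `L²` input gives states that are differentiable only almost everywhere. This product rule,
integration by parts for absolutely continuous functions, is what allows quadratic forms to be
differentiated along them. -/
theorem mul {f f' g g' : ℝ → ℝ} (hf : IsPrimitive f f') (hg : IsPrimitive g g') :
    IsPrimitive (fun t => f t * g t) (fun t => f' t * g t + f t * g' t) := by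
  have hI : ∀ T : ℝ, 0 ≤ T → Set.uIcc 0 T ⊆ Set.Ici 0 := fun T hT => by
    rw [Set.uIcc_of_le hT]; exact Set.Icc_subset_Ici_self
  refine ⟨fun T hT => ((hf.1 T hT).mul_continuousOn (hg.continuousOn.mono (hI T hT))).add
    ((hg.1 T hT).continuousOn_mul (hf.continuousOn.mono (hI T hT))), fun T hT => ?_⟩
  -- `φ` is unconstrained at negative times, so the integral formula replaces it.
  have hac : ∀ {φ φ' : ℝ → ℝ}, IsPrimitive φ φ' →
      AbsolutelyContinuousOnInterval (fun t => φ 0 + ∫ s in (0 : ℝ)..t, φ' s) 0 T := by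
    intro φ φ' hφ
    have h1 := (hφ.1 T hT).absolutelyContinuousOnInterval_intervalIntegral (c := 0) (by simp)
    have h2 : AbsolutelyContinuousOnInterval (fun _ : ℝ => φ 0) 0 T :=
      (LipschitzWith.const (φ 0)).lipschitzOnWith.absolutelyContinuousOnInterval
    exact h2.add h1
  have hder : ∀ {φ φ' : ℝ → ℝ}, IsPrimitive φ φ' → ∀ᵐ t, t ∈ Set.uIcc 0 T →
      deriv (fun t => φ 0 + ∫ s in (0 : ℝ)..t, φ' s) t = φ' t := by
    intro φ φ' hφ
    filter_upwards [(hφ.1 T hT).ae_hasDerivAt_integral] with t ht hmem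
    exact ((ht hmem 0 (by simp)).const_add _).deriv
  have h := (hac hf).integral_deriv_mul_eq_sub (hac hg)
  simp only [intervalIntegral.integral_same, add_zero, ← hf.2 T hT, ← hg.2 T hT] at h
  rw [← sub_eq_iff_eq_add', ← h]
  apply intervalIntegral.integral_congr_ae
  filter_upwards [hder hf, hder hg] with t h1 h2 ht
  have ht' := Set.uIoc_subset_uIcc ht
  have ht0 : 0 ≤ t := hI T hT ht'
  rw [h1 ht', h2 ht', ← hf.2 t ht0, ← hg.2 t ht0]

theorem of_hasDerivAt {f f' : ℝ → ℝ} (h : ∀ t, HasDerivAt f (f' t) t) (hc : Continuous f') :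
    IsPrimitive f f' := by
  refine ⟨fun T _ => hc.intervalIntegrable _ _, fun T _ => ?_⟩
  rw [intervalIntegral.integral_eq_sub_of_hasDerivAt (fun t _ => h t) (hc.intervalIntegrable _ _)]
  ring

theorem dotProduct {ι : Type*} [Fintype ι] {x x' y y' : ℝ → ι → ℝ}
    (hx : ∀ i, IsPrimitive (fun t => x t i) (fun t => x' t i))
    (hy : ∀ i, IsPrimitive (fun t => y t i) (fun t => y' t i)) :
    IsPrimitive (fun t => x t ⬝ᵥ y t) (fun t => x' t ⬝ᵥ y t + x t ⬝ᵥ y' t) := by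
  simp only [_root_.dotProduct, ← Finset.sum_add_distrib]
  exact sum _ fun i _ => (hx i).mul (hy i)

theorem mulVec {ι κ : Type*} [Fintype ι] {x x' : ℝ → ι → ℝ} (M : Matrix κ ι ℝ)
    (hx : ∀ i, IsPrimitive (fun t => x t i) (fun t => x' t i)) (k : κ) :
    IsPrimitive (fun t => (M *ᵥ x t) k) (fun t => (M *ᵥ x' t) k) := by
  simp only [Matrix.mulVec, _root_.dotProduct]
  exact sum _ fun i _ => (hx i).const_mul _

end IsPrimitive

/-! ### Carathéodory solutions, componentwise. -/

section Solutions

variable {ι : Type*} [Fintype ι]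

theorem intervalIntegrable_pi {f : ℝ → ι → ℝ} {a b : ℝ} :
    IntervalIntegrable f volume a b ↔ ∀ i, IntervalIntegrable (fun t => f t i) volume a b := by
  simp only [intervalIntegrable_iff, IntegrableOn]
  exact ⟨fun h i => h.eval i, fun h => Integrable.of_eval h⟩

theorem isSolution_iff {A : Matrix ι ι ℝ} {f : ℝ → ι → ℝ} {x₀ : ι → ℝ} {x : ℝ → ι → ℝ}
    (hf : ∀ T, 0 ≤ T → IntervalIntegrable f volume 0 T) :
    IsSolution A f x₀ x ↔
      x 0 = x₀ ∧ ∀ i, IsPrimitive (fun t => x t i) (fun t => (A *ᵥ x t + f t) i) := by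
  have hint : ContinuousOn x (Set.Ici 0) →
      ∀ T, 0 ≤ T → IntervalIntegrable (fun t => A *ᵥ x t + f t) volume 0 T := by
    intro hc T hT
    refine IntervalIntegrable.add ?_ (hf T hT)
    apply ContinuousOn.intervalIntegrable
    rw [Set.uIcc_of_le hT]
    exact (Continuous.matrix_mulVec continuous_const continuous_id).comp_continuousOn
      (hc.mono Set.Icc_subset_Ici_self)
  have heval : ContinuousOn x (Set.Ici 0) → ∀ T, 0 ≤ T → ∀ i,
      (∫ s in (0 : ℝ)..T, (A *ᵥ x s + f s)) i = ∫ s in (0 : ℝ)..T, (A *ᵥ x s + f s) i := by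
    intro hc T hT i
    have := hint hc T hT
    rw [intervalIntegral.integral_of_le hT, intervalIntegral.integral_of_le hT,
      eval_integral]
    rw [intervalIntegrable_iff_integrableOn_Ioc_of_le hT] at this
    exact fun i => this.eval i
  constructor
  · rintro ⟨hc, h⟩
    have h0 : x 0 = x₀ := by simpa using h 0 le_rfl
    refine ⟨h0, fun i => ⟨fun T hT => intervalIntegrable_pi.1 (hint hc T hT) i, fun T hT => ?_⟩⟩
    rw [h0, ← heval hc T hT, h T hT, Pi.add_apply]
  · rintro ⟨h0, h⟩
    have hc : ContinuousOn x (Set.Ici 0) := continuousOn_pi.2 fun i => (h i).continuousOn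
    refine ⟨hc, fun T hT => ?_⟩
    ext i
    rw [Pi.add_apply, heval hc T hT, ← h0]
    exact (h i).2 T hT

end Solutions

/-! ### Existence, uniqueness and decay of solutions of linear systems. -/

section Solutions

variable {ι : Type*} [Fintype ι]

/-- Variation of constants with the matrix exponential. -/
theorem exists_hasDerivAt_mulVec_add (A : Matrix ι ι ℝ) {g : ℝ → ι → ℝ} (hg : Continuous g)
    (x₀ : ι → ℝ) : ∃ x : ℝ → ι → ℝ, x 0 = x₀ ∧ ∀ t, HasDerivAt x (A *ᵥ x t + g t) t := by
  classical
  let L : (ι → ℝ) →L[ℝ] (ι → ℝ) := A.mulVecLin.toContinuousLinearMap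
  have hE : ∀ t : ℝ, HasDerivAt (fun s : ℝ => NormedSpace.exp (s • L))
      (L * NormedSpace.exp (t • L)) t := fun t => hasDerivAt_exp_smul_const' L t
  have hc : Continuous fun s : ℝ => NormedSpace.exp (s • L) :=
    continuous_iff_continuousAt.2 fun t => (hE t).continuousAt
  have hinv : ∀ t : ℝ, NormedSpace.exp (t • L) * NormedSpace.exp ((-t) • L) = 1 := by
    intro t
    let := NormedAlgebra.restrictScalars ℚ ℝ ((ι → ℝ) →L[ℝ] ι → ℝ)
    rw [← NormedSpace.exp_add_of_commute, ← add_smul, add_neg_cancel, zero_smul,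
      NormedSpace.exp_zero]
    exact ((Commute.refl L).smul_left _).smul_right _
  have hc' : Continuous fun s : ℝ => NormedSpace.exp ((-s) • L) (g s) :=
    (hc.comp continuous_neg).clm_apply hg
  refine ⟨fun t => NormedSpace.exp (t • L)
    (x₀ + ∫ s in (0 : ℝ)..t, NormedSpace.exp ((-s) • L) (g s)), by simp, fun t => ?_⟩
  have h1 := (hE t).clm_apply
    ((intervalIntegral.integral_hasDerivAt_right (hc'.intervalIntegrable 0 t)
      (hc'.stronglyMeasurableAtFilter _ _) hc'.continuousAt).const_add x₀)
  have h2 : NormedSpace.exp (t • L) (NormedSpace.exp ((-t) • L) (g t)) = g t := by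
    rw [← mul_apply_eq_comp, hinv]; rfl
  rw [h2] at h1
  exact h1

theorem exists_isSolution (A : Matrix ι ι ℝ) {f : ℝ → ι → ℝ}
    (hf : ∀ T, 0 ≤ T → IntervalIntegrable f volume 0 T) (x₀ : ι → ℝ) :
    ∃ x, IsSolution A f x₀ x := by
  -- Extension by zero makes the primitive `F` continuous on the whole line. The difference `w = x -
  -- F` then solves `w' = A w + A F`, whose forcing term is continuous.
  let f₀ : ℝ → ι → ℝ := (Set.Ioi 0).indicator f
  have hf₀ : ∀ a b, IntervalIntegrable f₀ volume a b := by
    have h0 : ∀ b, IntervalIntegrable f₀ volume 0 b := by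
      intro b
      rcases le_total 0 b with hb | hb
      · refine (hf b hb).congr fun s hs => ?_
        rw [Set.uIoc_of_le hb] at hs
        exact (Set.indicator_of_mem (show s ∈ Set.Ioi (0 : ℝ) from hs.1) f).symm
      · refine (intervalIntegrable_const (c := 0)).congr fun s hs => ?_
        rw [Set.uIoc_of_ge hb] at hs
        exact (Set.indicator_of_notMem (by simpa using hs.2) f).symm
    exact fun a b => (h0 a).symm.trans (h0 b)
  let F : ℝ → ι → ℝ := fun t => ∫ s in (0 : ℝ)..t, f₀ s
  have hF : Continuous F := intervalIntegral.continuous_primitive hf₀ 0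
  obtain ⟨w, hw0, hw⟩ := exists_hasDerivAt_mulVec_add A
    (Continuous.matrix_mulVec continuous_const hF : Continuous fun t => A *ᵥ F t) x₀
  have hwc : Continuous w := continuous_iff_continuousAt.2 fun t => (hw t).continuousAt
  refine ⟨fun t => w t + F t, (hwc.add hF).continuousOn, fun T hT => ?_⟩
  have hc1 : Continuous fun s => A *ᵥ w s + A *ᵥ F s :=
    (Continuous.matrix_mulVec continuous_const hwc).add (Continuous.matrix_mulVec continuous_const hF)
  have h1 : ∫ s in (0 : ℝ)..T, (A *ᵥ (w s + F s) + f s)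
      = (∫ s in (0 : ℝ)..T, (A *ᵥ w s + A *ᵥ F s)) + ∫ s in (0 : ℝ)..T, f s := by
    rw [← intervalIntegral.integral_add (hc1.intervalIntegrable _ _) (hf T hT)]
    simp only [mulVec_add]
  have h2 : F T = ∫ s in (0 : ℝ)..T, f s := by
    refine intervalIntegral.integral_congr_ae (Filter.Eventually.of_forall fun s hs => ?_)
    rw [Set.uIoc_of_le hT] at hs
    exact Set.indicator_of_mem (show s ∈ Set.Ioi (0 : ℝ) from hs.1) f
  change w T + F T = _
  rw [h1, intervalIntegral.integral_eq_sub_of_hasDerivAt (fun t _ => hw t)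
    (hc1.intervalIntegrable _ _), hw0, h2]
  abel

/-- Uniqueness by duality: if `y' = -Aᵀ y` with `y(T) = w`, then `z ⬝ᵥ y` is constant, so `z(T) ⬝ᵥ w
= 0` for every `w`. -/
theorem IsPrimitive.eq_zero_of_mulVec {A : Matrix ι ι ℝ} {z : ℝ → ι → ℝ} (h0 : z 0 = 0)
    (h : ∀ i, IsPrimitive (fun t => z t i) (fun t => (A *ᵥ z t) i)) {T : ℝ} (hT : 0 ≤ T) :
    z T = 0 := by
  refine dotProduct_eq_zero _ fun w => ?_
  obtain ⟨y, hy0, hy⟩ := exists_hasDerivAt_mulVec_add (-Aᵀ) (continuous_const (y := (0 : ι → ℝ))) w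
  have hy' : ∀ t, HasDerivAt (fun t => y (t - T)) (-Aᵀ *ᵥ y (t - T)) t := fun t => by
    simpa using (hy (t - T)).comp_sub_const t T
  have hyc : Continuous fun t => y (t - T) :=
    continuous_iff_continuousAt.2 fun t => (hy' t).continuousAt
  have hp := IsPrimitive.dotProduct h (y := fun t => y (t - T))
    (y' := fun t => -Aᵀ *ᵥ y (t - T)) fun i =>
      .of_hasDerivAt (fun t => hasDerivAt_pi.1 (hy' t) i)
        ((continuous_apply i).comp (Continuous.matrix_mulVec continuous_const hyc))
  have := hp.2 T hT
  simp only [sub_self, hy0, h0, zero_dotProduct, zero_add] at this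
  rw [this]
  refine intervalIntegral.integral_zero_ae (Filter.Eventually.of_forall fun s _ => ?_)
  rw [neg_mulVec, dotProduct_neg, mulVec_transpose, dotProduct_comm (z s), ← dotProduct_mulVec,
    dotProduct_comm, add_neg_cancel]

theorem IsSolution.eqOn {A : Matrix ι ι ℝ} {f : ℝ → ι → ℝ}
    (hf : ∀ T, 0 ≤ T → IntervalIntegrable f volume 0 T) {x₀ : ι → ℝ} {x y : ℝ → ι → ℝ}
    (hx : IsSolution A f x₀ x) (hy : IsSolution A f x₀ y) : Set.EqOn x y (Set.Ici 0) := by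
  rw [isSolution_iff hf] at hx hy
  intro t ht
  refine sub_eq_zero.1 (IsPrimitive.eq_zero_of_mulVec (A := A) (z := fun t => x t - y t) ?_ ?_ ht)
  · rw [hx.1, hy.1, sub_self]
  · intro i
    refine ((hx.2 i).sub (hy.2 i)).congr (fun _ _ => rfl) fun s _ => ?_
    simp [mulVec_sub]

/-- Exponential decay of a mode: a scalar equation with an exponentially decaying forcing term. -/
theorem exists_norm_le_exp_of_hasDerivAt {φ ψ : ℝ → ℂ} {μ : ℂ} {c K : ℝ} (hc : μ.re < -c)
    (hφ : ∀ t, HasDerivAt φ (μ * φ t + ψ t) t) (hψ : ∀ t, 0 ≤ t → ‖ψ t‖ ≤ K * Real.exp (-c * t)) :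
    ∃ K', ∀ t, 0 ≤ t → ‖φ t‖ ≤ K' * Real.exp (-c * t) := by
  -- The integrating factor `exp (-μ s)` turns the forcing term into one of size `K * exp (δ s)`.
  -- Since `δ > 0`, integration costs only a factor `1 / δ` and the rate `c` is kept, so the
  -- estimate can be iterated along a Jordan chain.
  set δ := -c - μ.re with hδ
  have hδ0 : 0 < δ := by linarith
  have hK : 0 ≤ K := by simpa using (norm_nonneg _).trans (hψ 0 le_rfl)
  refine ⟨‖φ 0‖ + K / δ, fun t ht => ?_⟩
  have hder : ∀ s : ℝ, HasDerivAt (fun s : ℝ => Complex.exp (-μ * s) * φ s)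
      (Complex.exp (-μ * s) * ψ s) s := by
    intro s
    have h1 : HasDerivAt (fun s : ℝ => Complex.exp (-μ * s)) (Complex.exp (-μ * s) * (-μ)) s := by
      have := ((hasDerivAt_id s).ofReal_comp.const_mul (-μ)).cexp
      simpa using this
    refine (h1.mul (hφ s)).congr_deriv ?_
    ring
  have hB : ∀ s : ℝ, HasDerivAt (fun s : ℝ => ‖φ 0‖ + K / δ * Real.exp (δ * s))
      (K * Real.exp (δ * s)) s := by
    intro s
    have := (((hasDerivAt_id s).const_mul δ).exp.const_mul (K / δ)).const_add ‖φ 0‖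
    refine this.congr_deriv ?_
    field_simp
    simp
  have hn : ∀ s : ℝ, ‖Complex.exp (-μ * s)‖ = Real.exp (-μ.re * s) := by
    intro s; rw [Complex.norm_exp]; simp
  have key := image_norm_le_of_norm_deriv_right_le_deriv_boundary (a := 0) (b := t)
    (fun s _ => (hder s).continuousAt.continuousWithinAt) (fun s _ => (hder s).hasDerivWithinAt)
    (by simp; positivity) hB (fun s hs => by
      rw [norm_mul, hn]
      calc _ ≤ Real.exp (-μ.re * s) * (K * Real.exp (-c * s)) := by
            gcongr; exact hψ s hs.1
        _ = K * Real.exp (δ * s) := by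
            rw [mul_left_comm, ← Real.exp_add]; congr 2; rw [hδ]; ring) ⟨ht, le_rfl⟩
  rw [norm_mul, hn] at key
  have h3 : ‖φ t‖ = Real.exp (μ.re * t) * (Real.exp (-μ.re * t) * ‖φ t‖) := by
    rw [← mul_assoc, ← Real.exp_add]; simp
  rw [h3]
  calc _ ≤ Real.exp (μ.re * t) * (‖φ 0‖ + K / δ * Real.exp (δ * t)) := by gcongr
    _ = ‖φ 0‖ * Real.exp (μ.re * t) + K / δ * (Real.exp (μ.re * t) * Real.exp (δ * t)) := by ring
    _ ≤ ‖φ 0‖ * Real.exp (-c * t) + K / δ * Real.exp (-c * t) := by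
        rw [← Real.exp_add, hδ]
        gcongr
        linarith
    _ = _ := by ring

/-- For a generalized eigenvector `w` of `Aᵀ`, the mode `w ⬝ᵥ z` obeys a scalar equation with
eigenvalue `μ`, forced by the mode of `(Aᵀ - μ) w`, which has smaller height. Induction on the
height gives decay, and such `w` span the complex space. -/
theorem IsHurwitz.tendsto_zero_of_hasDerivAt [DecidableEq ι] {A : Matrix ι ι ℝ} (hA : IsHurwitz A)
    {z : ℝ → ι → ℝ} (hz : ∀ t, HasDerivAt z (A *ᵥ z t) t) :
    Filter.Tendsto z Filter.atTop (nhds 0) := by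
  let Ac : Matrix ι ι ℂ := A.map (algebraMap ℝ ℂ)
  let zc : ℝ → ι → ℂ := fun t i => (z t i : ℂ)
  let f : Module.End ℂ (ι → ℂ) := Matrix.toLin' Acᵀ
  have hzc : ∀ t, HasDerivAt zc (Ac *ᵥ zc t) t := by
    intro t
    refine hasDerivAt_pi.2 fun i => ?_
    refine (hasDerivAt_pi.1 (hz t) i).ofReal_comp.congr_deriv ?_
    simp [Ac, zc, mulVec, dotProduct]
  have hφ : ∀ (w : ι → ℂ) t, HasDerivAt (fun t => w ⬝ᵥ zc t) (f w ⬝ᵥ zc t) t := by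
    intro w t
    have : f w ⬝ᵥ zc t = ∑ i, w i * (Ac *ᵥ zc t) i := by
      simp only [f, toLin'_apply, mulVec_transpose]
      rw [← dotProduct_mulVec]; rfl
    rw [this]
    exact HasDerivAt.fun_sum fun i _ => (hasDerivAt_pi.1 (hzc t) i).const_mul (w i)
  have hgen : ∀ (μ : ℂ) (w : ι → ℂ), w ∈ f.maxGenEigenspace μ →
      Filter.Tendsto (fun t => w ⬝ᵥ zc t) Filter.atTop (nhds 0) := by
    intro μ w hw
    by_cases hμ : f.HasEigenvalue μ
    · have hre : μ.re < 0 := by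
        apply hA
        have h1 := hμ.mem_spectrum
        have h2 : spectrum ℂ f = spectrum ℂ Acᵀ := AlgEquiv.spectrum_eq (Matrix.toLinAlgEquiv' (R := ℂ)) Acᵀ
        rw [h2, Matrix.mem_spectrum_iff_isRoot_charpoly, Matrix.charpoly_transpose,
          ← Matrix.mem_spectrum_iff_isRoot_charpoly] at h1
        exact h1
      -- Any rate strictly between `0` and `-μ.re` works.
      set c := -μ.re / 2 with hcdef
      have hdecay : ∀ (k : ℕ) (w : ι → ℂ), ((f - algebraMap ℂ _ μ) ^ k) w = 0 →
          ∃ K, ∀ t, 0 ≤ t → ‖w ⬝ᵥ zc t‖ ≤ K * Real.exp (-c * t) := by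
        intro k
        induction k with
        | zero => intro w hw; exact ⟨0, by simp_all⟩
        | succ k ih =>
          intro w hw
          obtain ⟨K, hK⟩ := ih ((f - algebraMap ℂ _ μ) w) (by rwa [pow_succ] at hw)
          refine exists_norm_le_exp_of_hasDerivAt (μ := μ) (by linarith) (fun t => ?_) hK
          refine (hφ w t).congr_deriv ?_
          simp [sub_dotProduct]
      obtain ⟨k, hk⟩ := (Module.End.mem_maxGenEigenspace f μ w).1 hw
      obtain ⟨K, hK⟩ := hdecay k w hk
      refine squeeze_zero_norm' (a := fun t => K * Real.exp (-c * t))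
        (Filter.eventually_atTop.2 ⟨0, hK⟩) ?_
      have : Filter.Tendsto (fun t : ℝ => -c * t) Filter.atTop Filter.atBot :=
        Filter.tendsto_id.const_mul_atTop_of_neg (by linarith)
      simpa using (Real.tendsto_exp_atBot.comp this).const_mul K
    · obtain ⟨k, hk⟩ := (Module.End.mem_maxGenEigenspace f μ w).1 hw
      have hw0 : w = 0 := by
        by_contra hne
        refine hμ (Module.End.hasEigenvalue_of_hasGenEigenvalue (k := k) fun h => hne ?_)
        rw [← Submodule.mem_bot ℂ, ← h, Module.End.mem_genEigenspace_nat]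
        exact hk
      simp [hw0]
  have hall : ∀ w : ι → ℂ, Filter.Tendsto (fun t => w ⬝ᵥ zc t) Filter.atTop (nhds 0) := by
    intro w
    have hw : w ∈ ⨆ μ, f.maxGenEigenspace μ := by
      rw [Module.End.iSup_maxGenEigenspace_eq_top]; trivial
    induction hw using Submodule.iSup_induction' with
    | mem μ w hw => exact hgen μ w hw
    | zero => simp
    | add v w _ _ hv hw => simpa [add_dotProduct] using hv.add hw
  refine tendsto_pi_nhds.2 fun i => ?_
  have := (Complex.continuous_re.tendsto _).comp (hall (Pi.single i 1))
  simpa [Function.comp_def, zc] using this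

theorem IsHurwitz.tendsto_zero [DecidableEq ι] {A : Matrix ι ι ℝ} (hA : IsHurwitz A) {x₀ : ι → ℝ}
    {z : ℝ → ι → ℝ} (hz : IsSolution A 0 x₀ z) : Filter.Tendsto z Filter.atTop (nhds 0) := by
  have hf : ∀ T : ℝ, 0 ≤ T → IntervalIntegrable (0 : ℝ → ι → ℝ) volume 0 T :=
    fun _ _ => IntervalIntegrable.zero
  obtain ⟨y, hy0, hy⟩ := exists_hasDerivAt_mulVec_add A (continuous_const (y := (0 : ι → ℝ))) x₀
  simp only [add_zero] at hy
  have hyc : Continuous y := continuous_iff_continuousAt.2 fun t => (hy t).continuousAt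
  have hys : IsSolution A 0 x₀ y := (isSolution_iff hf).2 ⟨hy0, fun i =>
    (IsPrimitive.of_hasDerivAt (fun t => hasDerivAt_pi.1 (hy t) i) ((continuous_apply i).comp
      (Continuous.matrix_mulVec continuous_const hyc))).congr (fun _ _ => rfl) (by simp)⟩
  refine (hA.tendsto_zero_of_hasDerivAt hy).congr' ?_
  filter_upwards [Filter.eventually_ge_atTop 0] with t ht
  exact (hz.eqOn hf hys ht).symm

end Solutions

/-! ### Square-integrable functions on the half-line. -/

section SquareIntegrable

variable {E : Type*} [NormedAddCommGroup E]

theorem l2Norm_nonneg (f : ℝ → E) : 0 ≤ l2Norm f := Real.sqrt_nonneg _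

theorem SquareIntegrable.integrable_sq {f : ℝ → E} (hf : SquareIntegrable f) :
    IntegrableOn (fun t => ‖f t‖ ^ 2) (Set.Ici 0) :=
  (memLp_two_iff_integrable_sq_norm hf.1).1 hf

theorem SquareIntegrable.intervalIntegrable_sq {f : ℝ → E} (hf : SquareIntegrable f) {T : ℝ}
    (hT : 0 ≤ T) : IntervalIntegrable (fun t => ‖f t‖ ^ 2) volume 0 T := by
  rw [intervalIntegrable_iff_integrableOn_Ioc_of_le hT]
  exact hf.integrable_sq.mono_set fun t ht => ht.1.le

theorem SquareIntegrable.intervalIntegrable {f : ℝ → E} (hf : SquareIntegrable f) {T : ℝ}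
    (hT : 0 ≤ T) : IntervalIntegrable f volume 0 T := by
  rw [intervalIntegrable_iff_integrableOn_Ioc_of_le hT]
  have h : MemLp f 2 (volume.restrict (Set.Ioc 0 T)) :=
    MemLp.mono_measure (Measure.restrict_mono (fun t ht => ht.1.le) le_rfl) hf
  exact h.integrable (by norm_num)

theorem SquareIntegrable.intervalIntegral_sq_le {f : ℝ → E} (hf : SquareIntegrable f) {T : ℝ}
    (hT : 0 ≤ T) : ∫ t in (0 : ℝ)..T, ‖f t‖ ^ 2 ≤ l2Norm f ^ 2 := by
  rw [l2Norm, Real.sq_sqrt (integral_nonneg fun _ => sq_nonneg _),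
    intervalIntegral.integral_of_le hT]
  exact setIntegral_mono_set hf.integrable_sq (Filter.Eventually.of_forall fun _ => sq_nonneg _)
    (LE.le.eventuallyLE fun t ht => ht.1.le)

theorem l2Norm_eq_toReal_eLpNorm {f : ℝ → E} (hf : SquareIntegrable f) :
    l2Norm f = (eLpNorm f 2 (volume.restrict (Set.Ici 0))).toReal := by
  rw [MemLp.eLpNorm_eq_integral_rpow_norm two_ne_zero ENNReal.ofNat_ne_top hf,
    ENNReal.toReal_ofReal (by positivity), l2Norm, Real.sqrt_eq_rpow]
  simp

theorem SquareIntegrable.l2Norm_add_le {f g : ℝ → E} (hf : SquareIntegrable f)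
    (hg : SquareIntegrable g) : l2Norm (f + g) ≤ l2Norm f + l2Norm g := by
  rw [l2Norm_eq_toReal_eLpNorm hf, l2Norm_eq_toReal_eLpNorm hg,
    l2Norm_eq_toReal_eLpNorm (show SquareIntegrable (f + g) from MemLp.add hf hg), ← ENNReal.toReal_add hf.2.ne hg.2.ne]
  exact ENNReal.toReal_mono (ENNReal.add_ne_top.2 ⟨hf.2.ne, hg.2.ne⟩)
    (eLpNorm_add_le hf.1 hg.1 (by norm_num))

/-- All energy estimates are made on finite horizons. A bound uniform in `T` passes to the limit and
yields integrability and the norm bound together. -/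
theorem squareIntegrable_of_forall_integral_le {f : ℝ → E} (hf : ContinuousOn f (Set.Ici 0))
    {c : ℝ} (hc : 0 ≤ c) (h : ∀ T, 0 ≤ T → ∫ t in (0 : ℝ)..T, ‖f t‖ ^ 2 ≤ c ^ 2) :
    SquareIntegrable f ∧ l2Norm f ≤ c := by
  have hsq : ContinuousOn (fun t => ‖f t‖ ^ 2) (Set.Ici 0) := hf.norm.pow 2
  have hint : IntegrableOn (fun t => ‖f t‖ ^ 2) (Set.Ioi 0) := by
    refine integrableOn_Ioi_of_intervalIntegral_norm_bounded (c ^ 2) 0 (b := id) (l := Filter.atTop)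
      (fun T => ?_) Filter.tendsto_id ?_
    · exact ((hsq.mono Set.Icc_subset_Ici_self).integrableOn_Icc (b := T)).mono_set
        Set.Ioc_subset_Icc_self
    · filter_upwards [Filter.eventually_ge_atTop 0] with T hT
      simpa using h T hT
  constructor
  · refine (memLp_two_iff_integrable_sq_norm (hf.aestronglyMeasurable measurableSet_Ici)).2 ?_
    exact (integrableOn_Ici_iff_integrableOn_Ioi (by simp)).2 hint
  · refine Real.sqrt_le_iff.2 ⟨hc, ?_⟩
    rw [integral_Ici_eq_integral_Ioi]
    refine le_of_tendsto (intervalIntegral_tendsto_integral_Ioi 0 hint Filter.tendsto_id) ?_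
    filter_upwards [Filter.eventually_ge_atTop 0] with T hT
    exact h T hT

theorem squareIntegrable_of_eqOn_zero {f : ℝ → E} (h : ∀ t, 0 ≤ t → f t = 0) :
    SquareIntegrable f ∧ l2Norm f = 0 := by
  have := squareIntegrable_of_forall_integral_le (f := f)
    (continuousOn_const.congr fun t ht => h t ht) le_rfl fun T hT => by
      rw [intervalIntegral.integral_congr (g := fun _ => 0)]
      · simp
      · intro t ht
        rw [Set.uIcc_of_le hT] at ht
        simp [h t ht.1]
  exact ⟨this.1, le_antisymm this.2 (l2Norm_nonneg f)⟩

end SquareIntegrable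

theorem norm_sq_toLp {o : Type*} [Fintype o] (x : o → ℝ) : ‖(WithLp.toLp 2 x : EuclideanSpace ℝ o)‖ ^ 2 = x ⬝ᵥ x := by
  rw [EuclideanSpace.norm_sq_eq]
  simp [dotProduct, sq]

theorem continuousOn_output {ι o : Type*} [Fintype ι] {x : ℝ → ι → ℝ} (C : Matrix o ι ℝ) (hx : ContinuousOn x (Set.Ici 0)) :
    ContinuousOn (output C x) (Set.Ici 0) :=
  (PiLp.continuous_toLp 2 _).comp_continuousOn
    ((Continuous.matrix_mulVec continuous_const continuous_id).comp_continuousOn hx)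

/-! ### Gramians as Lyapunov functions. -/

section Systems

variable {ι κ o : Type*} [Fintype ι] [Fintype κ] [Fintype o]

theorem SquareIntegrable.intervalIntegrable_forcing {u : ℝ → EuclideanSpace ℝ κ}
    (hu : SquareIntegrable u) (B : Matrix ι κ ℝ) (T : ℝ) (hT : 0 ≤ T) :
    IntervalIntegrable (forcing B u) volume 0 T := by
  have h := hu.intervalIntegrable hT
  let L : EuclideanSpace ℝ κ →L[ℝ] (ι → ℝ) :=
    (B.mulVecLin ∘ₗ (WithLp.linearEquiv 2 ℝ (κ → ℝ)).toLinearMap).toContinuousLinearMap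
  rw [intervalIntegrable_iff] at h ⊢
  exact L.integrable_comp h

/-- The output error of two autonomous systems with Hurwitz system matrices, in terms of the
observability Gramian of their difference. -/
theorem IsHurwitz.output_sub_autonomous {ι' : Type*} [Fintype ι'] [DecidableEq ι] [DecidableEq ι']
    {A : Matrix ι ι ℝ} {A' : Matrix ι' ι' ℝ} (hA : IsHurwitz A) (hA' : IsHurwitz A')
    {C : Matrix o ι ℝ} {C' : Matrix o ι' ℝ} {Q : Matrix ι ι ℝ} {Qm : Matrix ι ι' ℝ}
    {Q' : Matrix ι' ι' ℝ} (hQ : IsObservabilityGramian A C Q)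
    (hQm : Aᵀ * Qm + Qm * A' = Cᵀ * C') (hQ' : IsObservabilityGramian A' C' Q')
    {x₀ : ι → ℝ} {z₀ : ι' → ℝ} {x : ℝ → ι → ℝ} {z : ℝ → ι' → ℝ}
    (hx : IsSolution A 0 x₀ x) (hz : IsSolution A' 0 z₀ z) :
    0 ≤ x₀ ⬝ᵥ Q *ᵥ x₀ + 2 * (x₀ ⬝ᵥ Qm *ᵥ z₀) + z₀ ⬝ᵥ Q' *ᵥ z₀ ∧
    SquareIntegrable (output C x - output C' z) ∧
    l2Norm (output C x - output C' z) ≤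
      Real.sqrt (x₀ ⬝ᵥ Q *ᵥ x₀ + 2 * (x₀ ⬝ᵥ Qm *ᵥ z₀) + z₀ ⬝ᵥ Q' *ᵥ z₀) := by
  -- This is the quadratic form of the observability Gramian of the error system, with state `(x,
  -- z)` and output `C x - C' z`.
  set V : (ι → ℝ) → (ι' → ℝ) → ℝ := fun x z =>
    x ⬝ᵥ Q *ᵥ x + 2 * (x ⬝ᵥ Qm *ᵥ z) + z ⬝ᵥ Q' *ᵥ z with hV
  have hcx := hx.1
  have hcz := hz.1
  have hx0 := hA.tendsto_zero hx
  have hz0 := hA'.tendsto_zero hz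
  rw [isSolution_iff fun _ _ => IntervalIntegrable.zero] at hx hz
  simp only [Pi.zero_apply, add_zero] at hx hz
  have halg : ∀ (x : ι → ℝ) (z : ι' → ℝ),
      (A *ᵥ x) ⬝ᵥ Q *ᵥ x + x ⬝ᵥ Q *ᵥ (A *ᵥ x)
        + 2 * ((A *ᵥ x) ⬝ᵥ Qm *ᵥ z + x ⬝ᵥ Qm *ᵥ (A' *ᵥ z))
        + ((A' *ᵥ z) ⬝ᵥ Q' *ᵥ z + z ⬝ᵥ Q' *ᵥ (A' *ᵥ z))
      = -1 * ‖(WithLp.toLp 2 (C *ᵥ x) - WithLp.toLp 2 (C' *ᵥ z) : EuclideanSpace ℝ o)‖ ^ 2 := by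
    intro x z
    have e1 : (A *ᵥ x) ⬝ᵥ Q *ᵥ x + x ⬝ᵥ Q *ᵥ (A *ᵥ x) = -((C *ᵥ x) ⬝ᵥ (C *ᵥ x)) := by
      have := congrArg (fun M => x ⬝ᵥ M *ᵥ x) hQ
      simpa [add_mulVec, neg_mulVec, ← mulVec_mulVec, dotProduct_mulVec, vecMul_transpose] using this
    have e2 : (A *ᵥ x) ⬝ᵥ Qm *ᵥ z + x ⬝ᵥ Qm *ᵥ (A' *ᵥ z) = (C *ᵥ x) ⬝ᵥ (C' *ᵥ z) := by
      have := congrArg (fun M => x ⬝ᵥ M *ᵥ z) hQm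
      simpa [add_mulVec, ← mulVec_mulVec, dotProduct_mulVec, vecMul_transpose] using this
    have e3 : (A' *ᵥ z) ⬝ᵥ Q' *ᵥ z + z ⬝ᵥ Q' *ᵥ (A' *ᵥ z) = -((C' *ᵥ z) ⬝ᵥ (C' *ᵥ z)) := by
      have := congrArg (fun M => z ⬝ᵥ M *ᵥ z) hQ'
      simpa [add_mulVec, neg_mulVec, ← mulVec_mulVec, dotProduct_mulVec, vecMul_transpose] using this
    rw [e1, e2, e3, ← WithLp.toLp_sub, norm_sq_toLp, sub_dotProduct, dotProduct_sub, dotProduct_sub,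
      dotProduct_comm (C' *ᵥ z) (C *ᵥ x)]
    ring
  have hprim : IsPrimitive (fun t => V (x t) (z t))
      (fun t => -1 * ‖output C x t - output C' z t‖ ^ 2) := by
    refine (((IsPrimitive.dotProduct hx.2 (.mulVec Q hx.2)).add
      ((IsPrimitive.dotProduct hx.2 (.mulVec Qm hz.2)).const_mul 2)).add
      (IsPrimitive.dotProduct hz.2 (.mulVec Q' hz.2))).congr (fun _ _ => rfl) fun t _ => ?_
    exact (halg (x t) (z t)).symm
  have hint : ∀ T, 0 ≤ T →
      ∫ t in (0 : ℝ)..T, ‖output C x t - output C' z t‖ ^ 2 = V x₀ z₀ - V (x T) (z T) := by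
    intro T hT
    have := hprim.2 T hT
    rw [intervalIntegral.integral_const_mul, hx.1, hz.1] at this
    linarith
  have hlim : Filter.Tendsto (fun t => V x₀ z₀ - V (x t) (z t)) Filter.atTop (nhds (V x₀ z₀)) := by
    have hc : Continuous fun w : (ι → ℝ) × (ι' → ℝ) => V w.1 w.2 := by
      simp only [hV]
      fun_prop
    have := (hc.tendsto (0, 0)).comp (hx0.prodMk_nhds hz0)
    simpa [Function.comp_def, hV] using this.const_sub (V x₀ z₀)
  have hmono : ∀ T, 0 ≤ T →
      ∫ t in (0 : ℝ)..T, ‖output C x t - output C' z t‖ ^ 2 ≤ V x₀ z₀ := by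
    intro T hT
    refine ge_of_tendsto hlim ?_
    filter_upwards [Filter.eventually_ge_atTop T] with S hS
    rw [← hint S (hT.trans hS)]
    have hi : ∀ S, 0 ≤ S →
        IntervalIntegrable (fun t => ‖output C x t - output C' z t‖ ^ 2) volume 0 S := by
      intro S hS
      simpa using (hprim.1 S hS).const_mul (-1)
    exact intervalIntegral.integral_mono_interval le_rfl hT hS
      (Filter.Eventually.of_forall fun _ => sq_nonneg _) (hi S (hT.trans hS))
  have hnonneg : 0 ≤ V x₀ z₀ := by simpa using hmono 0 le_rfl
  refine ⟨hnonneg, squareIntegrable_of_forall_integral_le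
    ((continuousOn_output C hcx).sub (continuousOn_output C' hcz)) (Real.sqrt_nonneg _)
    fun T hT => ?_⟩
  rw [Real.sq_sqrt hnonneg]
  exact hmono T hT

/-- The form is the output energy released from `v`: compare with a system of zero output. -/
theorem IsObservabilityGramian.nonneg [DecidableEq ι] {A : Matrix ι ι ℝ} (hA : IsHurwitz A)
    {C : Matrix o ι ℝ} {Q : Matrix ι ι ℝ} (hQ : IsObservabilityGramian A C Q) (v : ι → ℝ) :
    0 ≤ v ⬝ᵥ Q *ᵥ v := by
  obtain ⟨x, hx⟩ := exists_isSolution A (f := 0) (fun _ _ => IntervalIntegrable.zero) v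
  have := (hA.output_sub_autonomous hA (C' := (0 : Matrix o ι ℝ)) (Qm := 0) (Q' := 0) hQ
    (by simp) (by simp [IsObservabilityGramian]) hx hx).1
  simpa using this

theorem IsHurwitz.transpose [DecidableEq ι] {A : Matrix ι ι ℝ} (hA : IsHurwitz A) :
    IsHurwitz Aᵀ := by
  intro μ hμ
  apply hA
  rw [Matrix.mem_spectrum_iff_isRoot_charpoly] at hμ ⊢
  rwa [Matrix.transpose_map, Matrix.charpoly_transpose] at hμ

theorem IsHurwitz.conj [DecidableEq ι] {A T : Matrix ι ι ℝ} (hA : IsHurwitz A)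
    (hT : IsUnit T.det) : IsHurwitz (T⁻¹ * A * T) := by
  intro μ hμ
  apply hA
  rw [Matrix.mem_spectrum_iff_isRoot_charpoly, Matrix.charpoly_map] at hμ ⊢
  rwa [Matrix.mul_assoc, Matrix.charpoly_mul_comm, Matrix.mul_assoc, Matrix.mul_nonsing_inv _ hT,
    Matrix.mul_one] at hμ

theorem IsControllabilityGramian.nonneg [DecidableEq ι] {A : Matrix ι ι ℝ} (hA : IsHurwitz A)
    {B : Matrix ι κ ℝ} {P : Matrix ι ι ℝ} (hP : IsControllabilityGramian A B P) (v : ι → ℝ) :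
    0 ≤ v ⬝ᵥ P *ᵥ v := by
  refine IsObservabilityGramian.nonneg hA.transpose (C := Bᵀ) ?_ v
  rw [IsObservabilityGramian, transpose_transpose, transpose_transpose]
  exact hP

end Systems

/-! ### Removing states from a system with diagonal Gramians. -/

section Truncation

variable {ι κ o : Type*} [Fintype ι] [DecidableEq ι] [Fintype κ] [Fintype o]

/-- `x` solves, with zero initial value, the system obtained from `x' = A x + f` by deleting the
states outside `S`; the deleted states are kept as zeros. -/
def IsTruncatedSolution (A : Matrix ι ι ℝ) (f : ℝ → ι → ℝ) (S : Finset ι) (x : ℝ → ι → ℝ) : Prop :=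
  x 0 = 0 ∧ ∀ i, IsPrimitive (fun t => x t i) (fun t => if i ∈ S then (A *ᵥ x t + f t) i else 0)

namespace IsTruncatedSolution

variable {A : Matrix ι ι ℝ} {f : ℝ → ι → ℝ} {S : Finset ι} {x y : ℝ → ι → ℝ}

theorem apply_eq_zero (hx : IsTruncatedSolution A f S x) {i : ι} (hi : i ∉ S) {t : ℝ}
    (ht : 0 ≤ t) : x t i = 0 := by
  have := (hx.2 i).2 t ht
  simpa [hi, hx.1] using this

theorem continuousOn (hx : IsTruncatedSolution A f S x) : ContinuousOn x (Set.Ici 0) :=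
  continuousOn_pi.2 fun i => (hx.2 i).continuousOn

theorem eq_of_nonneg (hx : IsTruncatedSolution A f S x) (hy : IsTruncatedSolution A f S y) {t : ℝ}
    (ht : 0 ≤ t) : x t = y t := by
  refine sub_eq_zero.1 (IsPrimitive.eq_zero_of_mulVec
    (A := Matrix.of fun i j => if i ∈ S then A i j else 0) (z := fun t => x t - y t) ?_ ?_ ht)
  · rw [hx.1, hy.1, sub_self]
  · intro i
    refine ((hx.2 i).sub (hy.2 i)).congr (fun _ _ => rfl) fun s _ => ?_
    by_cases hi : i ∈ S <;> simp [hi, mulVec, dotProduct, mul_sub]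

theorem exists_of_intervalIntegrable (A : Matrix ι ι ℝ)
    (hf : ∀ T, 0 ≤ T → IntervalIntegrable f volume 0 T) (S : Finset ι) :
    ∃ x, IsTruncatedSolution A f S x := by
  have hf' : ∀ T, 0 ≤ T →
      IntervalIntegrable (fun t i => if i ∈ S then f t i else 0) volume 0 T := by
    intro T hT
    refine intervalIntegrable_pi.2 fun i => ?_
    by_cases hi : i ∈ S
    · simpa [hi] using intervalIntegrable_pi.1 (hf T hT) i
    · simp [hi]
  obtain ⟨x, hx⟩ := exists_isSolution (Matrix.of fun i j => if i ∈ S then A i j else 0) hf' 0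
  rw [isSolution_iff hf'] at hx
  refine ⟨x, hx.1, fun i => (hx.2 i).congr (fun _ _ => rfl) fun t _ => ?_⟩
  by_cases hi : i ∈ S <;> simp [hi, mulVec, dotProduct]

end IsTruncatedSolution

theorem diagonal_controllability_form {A : Matrix ι ι ℝ} {B : Matrix ι κ ℝ} {p : ι → ℝ}
    (hP : IsControllabilityGramian A B (diagonal p)) (ξ : ι → ℝ) :
    2 * (ξ ⬝ᵥ A *ᵥ (fun i => p i * ξ i)) = -((ξ ᵥ* B) ⬝ᵥ (ξ ᵥ* B)) := by
  have h1 : diagonal p *ᵥ ξ = fun i => p i * ξ i := by ext i; simp [mulVec_diagonal]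
  have h := congrArg (fun M => ξ ⬝ᵥ M *ᵥ ξ) hP
  simp only [add_mulVec, neg_mulVec, ← mulVec_mulVec, dotProduct_add, dotProduct_neg, h1] at h
  have h2 : ξ ⬝ᵥ diagonal p *ᵥ (Aᵀ *ᵥ ξ) = ξ ⬝ᵥ A *ᵥ (fun i => p i * ξ i) := by
    have h4 : ξ ᵥ* diagonal p = fun i => p i * ξ i := by ext i; simp [vecMul_diagonal, mul_comm]
    rw [dotProduct_mulVec, h4, mulVec_transpose, dotProduct_comm, ← dotProduct_mulVec]
  have h3 : ξ ⬝ᵥ B *ᵥ (Bᵀ *ᵥ ξ) = (ξ ᵥ* B) ⬝ᵥ (ξ ᵥ* B) := by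
    rw [mulVec_transpose, dotProduct_mulVec]
  linarith

theorem diagonal_observability_form {A : Matrix ι ι ℝ} {C : Matrix o ι ℝ} {q : ι → ℝ}
    (hQ : IsObservabilityGramian A C (diagonal q)) (z : ι → ℝ) :
    2 * ((fun i => q i * z i) ⬝ᵥ A *ᵥ z) = -((C *ᵥ z) ⬝ᵥ (C *ᵥ z)) := by
  have h1 : diagonal q *ᵥ z = fun i => q i * z i := by ext i; simp [mulVec_diagonal]
  have h2 : z ᵥ* diagonal q = fun i => q i * z i := by ext i; simp [vecMul_diagonal, mul_comm]
  have h := congrArg (fun M => z ⬝ᵥ M *ᵥ z) hQ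
  simp only [add_mulVec, neg_mulVec, ← mulVec_mulVec, dotProduct_add, dotProduct_neg, h1] at h
  rw [dotProduct_mulVec, vecMul_transpose, dotProduct_mulVec z (diagonal q), h2,
    dotProduct_mulVec z Cᵀ, vecMul_transpose, dotProduct_comm (A *ᵥ z)] at h
  linarith

/-- Dissipation inequality for the truncation of one state of a system with diagonal Gramians. -/
theorem truncation_dissipation {A : Matrix ι ι ℝ} {B : Matrix ι κ ℝ} {C : Matrix o ι ℝ}
    {p q : ι → ℝ} (hP : IsControllabilityGramian A B (diagonal p))
    (hQ : IsObservabilityGramian A C (diagonal q)) {S : Finset ι} {i₀ : ι} (hi₀ : i₀ ∉ S)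
    (hp : ∀ i ∈ insert i₀ S, 0 < p i) (hq : ∀ i, 0 ≤ q i) {x y x' y' : ι → ℝ} {v : κ → ℝ}
    (hx : ∀ i, i ∉ insert i₀ S → x i = 0) (hy : ∀ i, i ∉ S → y i = 0)
    (hx' : ∀ i, x' i = if i ∈ insert i₀ S then (A *ᵥ x + B *ᵥ v) i else 0)
    (hy' : ∀ i, y' i = if i ∈ S then (A *ᵥ y + B *ᵥ v) i else 0) :
    ∑ i, q i * (2 * ((x i - y i) * (x' i - y' i)))
      + p i₀ * q i₀ * ∑ i, (p i)⁻¹ * (2 * ((x i + y i) * (x' i + y' i)))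
      ≤ 4 * (p i₀ * q i₀) * (v ⬝ᵥ v) - (C *ᵥ x - C *ᵥ y) ⬝ᵥ (C *ᵥ x - C *ᵥ y) := by
  -- `w` is the defect of `y` in the deleted equation. It enters the equation of `x - y` with sign
  -- `+` and that of `x + y` with sign `-`. As `y i₀ = 0`, the two contributions cancel under the
  -- weight `p i₀ * q i₀`.
  set w := (A *ᵥ y + B *ᵥ v) i₀ with hw
  set ξ : ι → ℝ := fun i => (p i)⁻¹ * (x i + y i) with hξ
  have hp0 : 0 < p i₀ := hp i₀ (by simp)
  have hyi : y i₀ = 0 := hy i₀ hi₀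
  have hZ : ∑ i, q i * (2 * ((x i - y i) * (x' i - y' i)))
      = -((C *ᵥ x - C *ᵥ y) ⬝ᵥ (C *ᵥ x - C *ᵥ y)) + 2 * q i₀ * (x i₀ * w) := by
    rw [← mulVec_sub, ← diagonal_observability_form hQ (x - y)]
    have : ∀ i, q i * (2 * ((x i - y i) * (x' i - y' i)))
        = 2 * (q i * (x - y) i * (A *ᵥ (x - y)) i) + if i = i₀ then 2 * q i * (x i * w) else 0 := by
      intro i
      by_cases h0 : i = i₀
      · subst h0
        simp only [hx', hy', hi₀, hyi, hw, mulVec_sub, Finset.mem_insert_self, if_true, if_false,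
          Pi.sub_apply, Pi.add_apply]
        ring
      · by_cases hS : i ∈ S
        · simp only [hx', hy', hS, h0, mulVec_sub, Finset.mem_insert_of_mem, if_true, if_false,
            Pi.sub_apply, Pi.add_apply]
          ring
        · have h1 : i ∉ insert i₀ S := by simp [h0, hS]
          simp [hx i h1, hy i hS, h0]
    rw [Finset.sum_congr rfl fun i _ => this i, Finset.sum_add_distrib, ← Finset.mul_sum]
    simp [dotProduct]
  have hpξ : (fun i => p i * ξ i) = x + y := by
    ext i
    by_cases hi : i ∈ insert i₀ S
    · simp [hξ, (hp i hi).ne']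
    · have hS : i ∉ S := fun h => hi (by simp [h])
      simp [hξ, hx i hi, hy i hS]
  have hX : ∑ i, (p i)⁻¹ * (2 * ((x i + y i) * (x' i + y' i)))
      = -((ξ ᵥ* B) ⬝ᵥ (ξ ᵥ* B)) + 4 * ((ξ ᵥ* B) ⬝ᵥ v) - 2 * (p i₀)⁻¹ * (x i₀ * w) := by
    rw [← diagonal_controllability_form hP ξ, hpξ, ← dotProduct_mulVec]
    have : ∀ i, (p i)⁻¹ * (2 * ((x i + y i) * (x' i + y' i)))
        = 2 * (ξ i * (A *ᵥ (x + y)) i) + 4 * (ξ i * (B *ᵥ v) i)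
          - if i = i₀ then 2 * (p i)⁻¹ * (x i * w) else 0 := by
      intro i
      by_cases h0 : i = i₀
      · subst h0
        simp only [hx', hy', hi₀, hyi, hw, hξ, mulVec_add, Finset.mem_insert_self, if_true, if_false,
          Pi.add_apply]
        ring
      · by_cases hS : i ∈ S
        · simp only [hx', hy', hS, h0, hξ, mulVec_add, Finset.mem_insert_of_mem, if_true, if_false,
            Pi.add_apply]
          ring
        · have h1 : i ∉ insert i₀ S := by simp [h0, hS]
          simp [hx i h1, hy i hS, h0, hξ]
    rw [Finset.sum_congr rfl fun i _ => this i, Finset.sum_sub_distrib, Finset.sum_add_distrib,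
      ← Finset.mul_sum, ← Finset.mul_sum]
    simp [dotProduct]
  -- Completing the square; this produces the constant `4`, hence the factor `2` of the final bound.
  have hsq : -((ξ ᵥ* B) ⬝ᵥ (ξ ᵥ* B)) + 4 * ((ξ ᵥ* B) ⬝ᵥ v) ≤ 4 * (v ⬝ᵥ v) := by
    have h : 0 ≤ (ξ ᵥ* B - (2 : ℝ) • v) ⬝ᵥ (ξ ᵥ* B - (2 : ℝ) • v) :=
      Finset.sum_nonneg fun i _ => mul_self_nonneg _
    simp only [sub_dotProduct, dotProduct_sub, smul_dotProduct, dotProduct_smul, smul_eq_mul,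
      dotProduct_comm v (ξ ᵥ* B)] at h
    linarith
  rw [hZ, hX]
  have h1 := mul_le_mul_of_nonneg_left hsq (mul_nonneg hp0.le (hq i₀))
  have h2 : p i₀ * q i₀ * (2 * (p i₀)⁻¹ * (x i₀ * w)) = 2 * q i₀ * (x i₀ * w) := by
    field_simp
  linarith

theorem integral_output_sub_le_of_truncate_one {A : Matrix ι ι ℝ} {B : Matrix ι κ ℝ}
    {C : Matrix o ι ℝ} {p q : ι → ℝ} (hP : IsControllabilityGramian A B (diagonal p))
    (hQ : IsObservabilityGramian A C (diagonal q)) {S : Finset ι} {i₀ : ι} (hi₀ : i₀ ∉ S)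
    (hp : ∀ i ∈ insert i₀ S, 0 < p i) (hq : ∀ i, 0 ≤ q i) {u : ℝ → EuclideanSpace ℝ κ}
    (hu : SquareIntegrable u) {x y : ℝ → ι → ℝ}
    (hx : IsTruncatedSolution A (forcing B u) (insert i₀ S) x)
    (hy : IsTruncatedSolution A (forcing B u) S y) {T : ℝ} (hT : 0 ≤ T) :
    ∫ t in (0 : ℝ)..T, ‖output C x t - output C y t‖ ^ 2
      ≤ 4 * (p i₀ * q i₀) * ∫ t in (0 : ℝ)..T, ‖u t‖ ^ 2 := by
  have hpq : 0 ≤ p i₀ * q i₀ := mul_nonneg (hp i₀ (by simp)).le (hq i₀)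
  have hZ := IsPrimitive.sum Finset.univ fun i _ =>
    (((hx.2 i).sub (hy.2 i)).mul ((hx.2 i).sub (hy.2 i))).const_mul (q i)
  have hX := IsPrimitive.sum Finset.univ fun i _ =>
    (((hx.2 i).add (hy.2 i)).mul ((hx.2 i).add (hy.2 i))).const_mul (p i)⁻¹
  have hV := hZ.add (hX.const_mul (p i₀ * q i₀))
  have hcont : ContinuousOn (fun t => ‖output C x t - output C y t‖ ^ 2) (Set.uIcc 0 T) := by
    rw [Set.uIcc_of_le hT]
    exact (((continuousOn_output C hx.continuousOn).sub
      (continuousOn_output C hy.continuousOn)).norm.pow 2).mono Set.Icc_subset_Ici_self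
  have hu2 := (hu.intervalIntegrable_sq hT).const_mul (4 * (p i₀ * q i₀))
  have hle := intervalIntegral.integral_mono_on hT (hV.1 T hT)
    (hu2.sub hcont.intervalIntegrable) (fun t ht => ?_)
  · rw [intervalIntegral.integral_sub hu2 hcont.intervalIntegrable,
      intervalIntegral.integral_const_mul] at hle
    have h := hV.2 T hT
    simp only [hx.1, hy.1, Pi.zero_apply, sub_zero, add_zero, mul_zero, Finset.sum_const_zero,
      zero_add] at h
    -- The storage function starts at zero and is nonnegative at `T`. Outside `insert i₀ S` the sign
    -- of `p i` is not known, but there both states vanish.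
    have hnn : 0 ≤ ∑ i, q i * ((x T i - y T i) * (x T i - y T i))
        + p i₀ * q i₀ * ∑ i, (p i)⁻¹ * ((x T i + y T i) * (x T i + y T i)) := by
      refine add_nonneg (Finset.sum_nonneg fun i _ => mul_nonneg (hq i) (mul_self_nonneg _))
        (mul_nonneg hpq (Finset.sum_nonneg fun i _ => ?_))
      by_cases hi : i ∈ insert i₀ S
      · exact mul_nonneg (inv_nonneg.2 (hp i hi).le) (mul_self_nonneg _)
      · have hS : i ∉ S := fun h => hi (by simp [h])
        simp [hx.apply_eq_zero hi hT, hy.apply_eq_zero hS hT]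
    rw [h] at hnn
    linarith
  · have hd := truncation_dissipation hP hQ hi₀ hp hq (x := x t) (y := y t) (v := (u t).ofLp)
      (fun i hi => hx.apply_eq_zero hi ht.1) (fun i hi => hy.apply_eq_zero hi ht.1)
      (fun i => rfl) (fun i => rfl)
    have e1 : ‖output C x t - output C y t‖ ^ 2
        = (C *ᵥ x t - C *ᵥ y t) ⬝ᵥ (C *ᵥ x t - C *ᵥ y t) := by
      rw [output, output, ← WithLp.toLp_sub, norm_sq_toLp]
    have e2 : ‖u t‖ ^ 2 = (u t).ofLp ⬝ᵥ (u t).ofLp := norm_sq_toLp _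
    rw [e1, e2]
    refine le_trans (le_of_eq ?_) hd
    congr 1
    · exact Finset.sum_congr rfl fun i _ => by simp only [forcing]; ring
    · congr 1
      exact Finset.sum_congr rfl fun i _ => by simp only [forcing]; ring

/-- Telescoping over the removed states, each step contributing `2 √(p i * q i)`. -/
theorem l2Norm_output_sub_le_of_truncate {A : Matrix ι ι ℝ} {B : Matrix ι κ ℝ}
    {C : Matrix o ι ℝ} {p q : ι → ℝ} (hP : IsControllabilityGramian A B (diagonal p))
    (hQ : IsObservabilityGramian A C (diagonal q)) {S R : Finset ι} (hSR : Disjoint R S)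
    (hp : ∀ i ∈ R ∪ S, 0 < p i) (hq : ∀ i, 0 ≤ q i) {u : ℝ → EuclideanSpace ℝ κ}
    (hu : SquareIntegrable u) {x y : ℝ → ι → ℝ}
    (hx : IsTruncatedSolution A (forcing B u) (R ∪ S) x)
    (hy : IsTruncatedSolution A (forcing B u) S y) :
    SquareIntegrable (output C x - output C y) ∧
      l2Norm (output C x - output C y) ≤ 2 * (∑ i ∈ R, Real.sqrt (p i * q i)) * l2Norm u := by
  induction R using Finset.induction_on generalizing x with
  | empty =>
    rw [Finset.empty_union] at hx
    have := squareIntegrable_of_eqOn_zero (f := output C x - output C y) fun t ht => by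
      simp [output, hx.eq_of_nonneg hy ht]
    exact ⟨this.1, by simp [this.2]⟩
  | insert i₀ R hi ih =>
    rw [Finset.disjoint_insert_left] at hSR
    rw [Finset.insert_union] at hx hp
    obtain ⟨z, hz⟩ := IsTruncatedSolution.exists_of_intervalIntegrable A
      (hu.intervalIntegrable_forcing B) (R ∪ S)
    have h1 := ih hSR.2 (fun i hi => hp i (Finset.mem_insert_of_mem hi)) hz
    have hpq : 0 ≤ p i₀ * q i₀ := mul_nonneg (hp i₀ (by simp)).le (hq i₀)
    have h2 : SquareIntegrable (output C x - output C z) ∧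
        l2Norm (output C x - output C z) ≤ 2 * Real.sqrt (p i₀ * q i₀) * l2Norm u := by
      have := l2Norm_nonneg u
      refine squareIntegrable_of_forall_integral_le ((continuousOn_output C hx.continuousOn).sub
        (continuousOn_output C hz.continuousOn)) (by positivity) fun T hT => ?_
      refine (integral_output_sub_le_of_truncate_one hP hQ (by simp [hi, hSR.1]) hp hq hu hx hz
        hT).trans ?_
      rw [mul_pow, mul_pow, Real.sq_sqrt hpq]
      norm_num only
      gcongr
      exact hu.intervalIntegral_sq_le hT
    have h3 : output C x - output C y = (output C x - output C z) + (output C z - output C y) := by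
      abel
    rw [h3, Finset.sum_insert hi]
    refine ⟨MemLp.add h2.1 h1.1, (h2.1.l2Norm_add_le h1.1).trans ?_⟩
    linarith [h1.2, h2.2]

/-- States with vanishing controllability Gramian entry are not reachable from zero. -/
theorem IsTruncatedSolution.restrict_reachable {A : Matrix ι ι ℝ} {B : Matrix ι κ ℝ} {p : ι → ℝ}
    (hP : IsControllabilityGramian A B (diagonal p)) {u : ℝ → EuclideanSpace ℝ κ} {x : ℝ → ι → ℝ}
    (hx : IsTruncatedSolution A (forcing B u) Finset.univ x) :
    IsTruncatedSolution A (forcing B u) (Finset.univ.filter fun i => p i ≠ 0) x := by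
  have hPij : ∀ i j, A i j * p j + p i * A j i = -∑ k, B i k * B j k := by
    intro i j
    have := congrFun (congrFun hP i) j
    rw [Matrix.add_apply, mul_diagonal, diagonal_mul, Matrix.neg_apply, mul_apply] at this
    exact this
  -- The diagonal entry of the Lyapunov equation is a vanishing sum of squares. Its off-diagonal
  -- entries then decouple the states with `p i = 0` from all others, so these states form an
  -- autonomous system starting at zero.
  have hB : ∀ i, p i = 0 → ∀ k, B i k = 0 := by
    intro i hi k
    have := hPij i i
    simp only [hi, mul_zero, zero_mul, add_zero, zero_eq_neg] at this
    have h := (Finset.sum_eq_zero_iff_of_nonneg fun k _ => mul_self_nonneg (B i k)).1 this k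
      (Finset.mem_univ k)
    exact mul_self_eq_zero.1 h
  have hAij : ∀ i j, p i = 0 → p j ≠ 0 → A i j = 0 := by
    intro i j hi hj
    have := hPij i j
    simp only [hi, zero_mul, add_zero, hB i hi, Finset.sum_const_zero, neg_zero] at this
    exact (mul_eq_zero.1 this).resolve_right hj
  have hAx : ∀ i, p i = 0 → ∀ t, (A *ᵥ x t + forcing B u t) i
      = (A *ᵥ fun j => if p j = 0 then x t j else 0) i := by
    intro i hi t
    have : (forcing B u t) i = 0 := by simp [forcing, mulVec, dotProduct, hB i hi]
    rw [Pi.add_apply, this, add_zero]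
    refine Finset.sum_congr rfl fun j _ => ?_
    by_cases hj : p j = 0
    · simp [hj]
    · simp [hAij i j hi hj]
  have hzero : ∀ t, 0 ≤ t → (fun j => if p j = 0 then x t j else 0) = 0 := by
    intro t ht
    refine IsPrimitive.eq_zero_of_mulVec
      (A := Matrix.of fun i j => if p i = 0 then A i j else 0)
      (z := fun t j => if p j = 0 then x t j else 0) ?_ (fun i => ?_) ht
    · ext j; simp [hx.1]
    · by_cases hi : p i = 0
      · refine (hx.2 i).congr (fun s _ => by simp [hi]) fun s _ => ?_
        simp only [Finset.mem_univ, if_true]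
        rw [hAx i hi s]
        simp [mulVec, dotProduct, hi]
      · refine IsPrimitive.zero.congr (fun s _ => by simp [hi]) fun s _ => ?_
        simp [mulVec, dotProduct, hi]
  refine ⟨hx.1, fun i => (hx.2 i).congr (fun _ _ => rfl) fun t ht => ?_⟩
  by_cases hi : p i = 0
  · simp only [Finset.mem_univ, if_true, hAx i hi t, hzero t ht]
    simp [hi]
  · simp [hi]

end Truncation

/-! ### Balanced truncation from zero initial values. -/

/-- The `L²` error bound of balanced truncation for vanishing initial values. -/
theorem IsBalancedTruncation.l2Norm_output_sub_le {N n : ℕ} {κ o : Type*} [Fintype κ] [Fintype o]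
    {A : Matrix (Fin N) (Fin N) ℝ} {B : Matrix (Fin N) κ ℝ} {C : Matrix o (Fin N) ℝ}
    {σ : Fin N → ℝ} {V W : Matrix (Fin N) (Fin n) ℝ} (hA : IsHurwitz A)
    (hVW : IsBalancedTruncation A B C σ V W) {u : ℝ → EuclideanSpace ℝ κ}
    (hu : SquareIntegrable u) {x : ℝ → Fin N → ℝ} {xr : ℝ → Fin n → ℝ}
    (hx : IsSolution A (forcing B u) 0 x)
    (hxr : IsSolution (Wᵀ * A * V) (forcing (Wᵀ * B) u) 0 xr) :
    SquareIntegrable (output C x - output (C * V) xr) ∧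
      l2Norm (output C x - output (C * V) xr) ≤ truncationBound σ n * l2Norm u := by
  obtain ⟨⟨-, hσ, -⟩, hgap, hn, T, ⟨hT, p, q, hP, hQ, hpq⟩, rfl, hW⟩ := hVW
  rw [isSolution_iff (hu.intervalIntegrable_forcing _)] at hx hxr
  rw [hW] at hxr
  set S : Finset (Fin N) := Finset.univ.filter fun i => (i : ℕ) < n with hS
  let y : ℝ → Fin N → ℝ := fun t => T⁻¹ *ᵥ x t
  -- The reduced state, padded by zeros, is the truncated solution in balanced coordinates.
  let yr : ℝ → Fin N → ℝ := fun t i => if h : (i : ℕ) < n then xr t ⟨i, h⟩ else 0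
  have hTy : ∀ t, T *ᵥ y t = x t := fun t => by
    simp only [y, mulVec_mulVec, mul_nonsing_inv _ hT, one_mulVec]
  have hsum : ∀ (M : Fin N → ℝ) t, ∑ j, M j * yr t j = ∑ j, M (Fin.castLE hn j) * xr t j := by
    intro M t
    symm
    refine Finset.sum_of_injOn (Fin.castLE hn) (Fin.castLE_injective hn).injOn (by simp)
      (fun j _ hj => ?_) fun j _ => by simp [yr]
    have : ¬ (j : ℕ) < n := fun h => hj ⟨⟨j, h⟩, by simp, by ext; simp⟩
    simp [yr, this]
  have hy : IsTruncatedSolution (T⁻¹ * A * T) (forcing (T⁻¹ * B) u) Finset.univ y := by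
    refine ⟨by simp [y, hx.1], fun i => (IsPrimitive.mulVec T⁻¹ hx.2 i).congr (fun _ _ => rfl)
      fun t _ => ?_⟩
    simp only [Finset.mem_univ, if_true, forcing]
    rw [← mulVec_mulVec, hTy, ← mulVec_mulVec, ← mulVec_mulVec, ← mulVec_add]
  have hyr : IsTruncatedSolution (T⁻¹ * A * T) (forcing (T⁻¹ * B) u) S yr := by
    refine ⟨by ext i; simp [yr, hxr.1], fun i => ?_⟩
    by_cases hi : (i : ℕ) < n
    · refine (hxr.2 ⟨i, hi⟩).congr (fun t _ => by simp [yr, hi]) fun t _ => ?_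
      have hiS : i ∈ S := by simp [hS, hi]
      rw [if_pos hiS, Pi.add_apply, Pi.add_apply]
      congr 1
      exact hsum _ t
    · refine IsPrimitive.zero.congr (fun t _ => by simp [yr, hi]) fun t _ => ?_
      simp [hS, hi]
  have hout : output C x - output (C * T.submatrix id (Fin.castLE hn)) xr
      = output (C * T) y - output (C * T) yr := by
    have h1 : output C x = output (C * T) y := by
      ext t : 1
      simp only [output, ← mulVec_mulVec, hTy]
    have h2 : output (C * T.submatrix id (Fin.castLE hn)) xr = output (C * T) yr := by
      ext t i
      exact (hsum (fun j => (C * T) i j) t).symm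
    rw [h1, h2]
  rw [hout]
  have hbound : 0 ≤ truncationBound σ n :=
    mul_nonneg zero_le_two (Finset.sum_nonneg fun i _ => hσ i)
  have hA' := hA.conj hT
  -- Where `σ i = 0`, balancing fixes only the product `p i * q i`; the signs come from stability.
  have hp : ∀ i, 0 ≤ p i := fun i => by simpa using hP.nonneg hA' (Pi.single i 1)
  have hq : ∀ i, 0 ≤ q i := fun i => by simpa using hQ.nonneg hA' (Pi.single i 1)
  have hsqrt : ∀ i, Real.sqrt (p i * q i) = σ i := by
    intro i
    by_cases h0 : σ i = 0
    · rw [(hpq i).2 h0, h0, Real.sqrt_zero]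
    · rw [((hpq i).1 h0).1, ((hpq i).1 h0).2, Real.sqrt_mul_self (hσ i)]
  -- For `n = N` nothing is truncated, and some `p i` may vanish among the kept states. For `n < N`
  -- the gap makes every kept `σ i`, hence `p i`, positive.
  rcases hn.eq_or_lt with rfl | hlt
  · have hSu : S = Finset.univ := by ext i; simp [hS]
    rw [hSu] at hyr
    have := squareIntegrable_of_eqOn_zero (f := output (C * T) y - output (C * T) yr) fun t ht => by
      simp [output, hy.eq_of_nonneg hyr ht]
    exact ⟨this.1, this.2.trans_le (mul_nonneg hbound (l2Norm_nonneg u))⟩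
  · set K : Finset (Fin N) := Finset.univ.filter fun i => p i ≠ 0 with hK
    have hSK : S ⊆ K := by
      intro i hi
      have hi' : (i : ℕ) < n := by simpa [hS] using hi
      have hpos : 0 < σ i := (hσ ⟨n, hlt⟩).trans_lt (hgap i ⟨n, hlt⟩ hi' le_rfl)
      simp [hK, ((hpq i).1 hpos.ne').1, hpos.ne']
    have hyK : IsTruncatedSolution (T⁻¹ * A * T) (forcing (T⁻¹ * B) u) (K \ S ∪ S) y := by
      rw [Finset.sdiff_union_of_subset hSK]
      exact hy.restrict_reachable hP
    have h := l2Norm_output_sub_le_of_truncate hP hQ Finset.sdiff_disjoint (fun i hi => by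
      rw [Finset.sdiff_union_of_subset hSK] at hi
      exact (hp i).lt_of_ne' (by simpa [hK] using hi)) hq hu hyK hyr
    refine ⟨h.1, h.2.trans (mul_le_mul_of_nonneg_right ?_ (l2Norm_nonneg u))⟩
    rw [truncationBound]
    refine mul_le_mul_of_nonneg_left ?_ zero_le_two
    rw [Finset.sum_congr rfl fun i _ => hsqrt i]
    refine Finset.sum_le_sum_of_subset_of_nonneg (fun i hi => ?_) fun i _ _ => hσ i
    simpa [hS] using (Finset.mem_sdiff.1 hi).2

/-! ### Superposition, padded inputs and the two error bounds. -/

theorem IsSolution.sub {ι : Type*} [Fintype ι] {A : Matrix ι ι ℝ} {f g : ℝ → ι → ℝ}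
    (hf : ∀ T, 0 ≤ T → IntervalIntegrable f volume 0 T)
    (hg : ∀ T, 0 ≤ T → IntervalIntegrable g volume 0 T) {x₀ y₀ : ι → ℝ} {x y : ℝ → ι → ℝ}
    (hx : IsSolution A f x₀ x) (hy : IsSolution A g y₀ y) :
    IsSolution A (f - g) (x₀ - y₀) (x - y) := by
  rw [isSolution_iff hf] at hx
  rw [isSolution_iff hg] at hy
  rw [isSolution_iff (f := f - g) fun T hT => (hf T hT).sub (hg T hT)]
  refine ⟨by simp [hx.1, hy.1], fun i => ((hx.2 i).sub (hy.2 i)).congr (fun _ _ => rfl)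
    fun t _ => ?_⟩
  simp only [Pi.sub_apply, mulVec_sub, Pi.add_apply]
  ring

theorem output_sub {ι o : Type*} [Fintype ι] (C : Matrix o ι ℝ) (x y : ℝ → ι → ℝ) :
    output C (x - y) = output C x - output C y := by
  ext t : 1
  simp [output, mulVec_sub]

/-- Identifies the estimator with the root of the error system's Lyapunov form at `(x₀, Wᵀ x₀)`. -/
theorem errorEstimator_eq {N n m : ℕ} {Q : Matrix (Fin N) (Fin N) ℝ} {U : Matrix (Fin m) (Fin N) ℝ}
    (hU : Q = Uᵀ * U) (Qm : Matrix (Fin N) (Fin n) ℝ) (Qr : Matrix (Fin n) (Fin n) ℝ)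
    (W : Matrix (Fin N) (Fin n) ℝ) (x₀ : Fin N → ℝ) :
    errorEstimator U Qm Qr W x₀ = Real.sqrt (x₀ ⬝ᵥ Q *ᵥ x₀ + 2 * (x₀ ⬝ᵥ Qm *ᵥ (Wᵀ *ᵥ x₀))
      + (Wᵀ *ᵥ x₀) ⬝ᵥ Qr *ᵥ (Wᵀ *ᵥ x₀)) := by
  rw [errorEstimator, norm_sq_toLp, hU]
  congr 2
  · rw [← mulVec_mulVec, ← mulVec_mulVec, dotProduct_mulVec x₀ Uᵀ, vecMul_transpose]
  · rw [← mulVec_mulVec, ← mulVec_mulVec, dotProduct_mulVec x₀ W, mulVec_transpose]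

theorem l2Norm_add_le_of_le {E : Type*} [NormedAddCommGroup E] {f g : ℝ → E} {a b : ℝ}
    (hf : SquareIntegrable f ∧ l2Norm f ≤ a) (hg : SquareIntegrable g ∧ l2Norm g ≤ b) :
    SquareIntegrable (f + g) ∧ l2Norm (f + g) ≤ a + b :=
  ⟨MemLp.add hf.1 hg.1, (hf.1.l2Norm_add_le hg.1).trans (add_le_add hf.2 hg.2)⟩

/-- A control `u` of a system with input matrix `B`, as a control for the input matrix `[B, X]`. -/
noncomputable def extendInput {κ κ' : Type*} (u : ℝ → EuclideanSpace ℝ κ) :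
    ℝ → EuclideanSpace ℝ (κ ⊕ κ') :=
  fun t => WithLp.toLp 2 (Sum.elim (u t).ofLp 0)

section extendInput

variable {κ κ' : Type*} [Fintype κ] [Fintype κ']

theorem norm_extendInput (u : ℝ → EuclideanSpace ℝ κ) (t : ℝ) :
    ‖(extendInput u t : EuclideanSpace ℝ (κ ⊕ κ'))‖ = ‖u t‖ := by
  rw [EuclideanSpace.norm_eq, EuclideanSpace.norm_eq]
  simp [extendInput]

theorem l2Norm_extendInput (u : ℝ → EuclideanSpace ℝ κ) :
    l2Norm (extendInput u : ℝ → EuclideanSpace ℝ (κ ⊕ κ')) = l2Norm u := by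
  simp only [l2Norm, norm_extendInput]

theorem SquareIntegrable.extendInput {u : ℝ → EuclideanSpace ℝ κ} (hu : SquareIntegrable u) :
    SquareIntegrable (extendInput u : ℝ → EuclideanSpace ℝ (κ ⊕ κ')) := by
  have hc : Continuous fun v : EuclideanSpace ℝ κ =>
      (WithLp.toLp 2 (Sum.elim v.ofLp 0) : EuclideanSpace ℝ (κ ⊕ κ')) := by
    refine (PiLp.continuous_toLp 2 _).comp (continuous_pi fun i => ?_)
    rcases i with i | i
    · exact (continuous_apply i).comp (PiLp.continuous_ofLp 2 _)
    · exact continuous_const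
  exact MemLp.of_le hu (hc.comp_aestronglyMeasurable hu.1)
    (Filter.Eventually.of_forall fun t => (norm_extendInput u t).le)

theorem forcing_fromCols_extendInput {ι : Type*} (B : Matrix ι κ ℝ) (X : Matrix ι κ' ℝ)
    (u : ℝ → EuclideanSpace ℝ κ) : forcing (fromCols B X) (extendInput u) = forcing B u := by
  ext t i
  simp [forcing, extendInput, fromCols_mulVec]

end extendInput

theorem corollary1 {N q p m : ℕ}
    -- the full order model, its observability Gramian with exact factor `U`
    (A : Matrix (Fin N) (Fin N) ℝ) (B : Matrix (Fin N) (Fin q) ℝ) (C : Matrix (Fin p) (Fin N) ℝ)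
    (hA : IsHurwitz A)
    (Q : Matrix (Fin N) (Fin N) ℝ) (hQ : IsObservabilityGramian A C Q)
    (U : Matrix (Fin m) (Fin N) ℝ) (hU : Q = Uᵀ * U)
    -- an arbitrary initial value, a square-integrable input, and the resulting state
    (x₀ : Fin N → ℝ) (u : ℝ → EuclideanSpace ℝ (Fin q)) (hu : SquareIntegrable u)
    (x : ℝ → Fin N → ℝ) (hx : IsSolution A (forcing B u) x₀ x) :
    -- BT-aug: balanced truncation of `(A, [B, X₀], C)` yields the bases that project the full model
    (∀ (N₀ n : ℕ) (X₀ : Matrix (Fin N) (Fin N₀) ℝ) (σ : Fin N → ℝ)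
        (V W : Matrix (Fin N) (Fin n) ℝ),
      IsBalancedTruncation A (Matrix.fromCols B X₀) C σ V W →
      IsHurwitz (Wᵀ * A * V) →
      ∀ (Qm : Matrix (Fin N) (Fin n) ℝ) (Qr : Matrix (Fin n) (Fin n) ℝ),
      Aᵀ * Qm + Qm * (Wᵀ * A * V) = Cᵀ * (C * V) →
      IsObservabilityGramian (Wᵀ * A * V) (C * V) Qr →
      ∀ xr : ℝ → Fin n → ℝ,
      IsSolution (Wᵀ * A * V) (forcing (Wᵀ * B) u) (Wᵀ *ᵥ x₀) xr →
        SquareIntegrable (output C x - output (C * V) xr) ∧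
        l2Norm (output C x - output (C * V) xr) ≤
          truncationBound σ n * l2Norm u + errorEstimator U Qm Qr W x₀) ∧
    -- splitted approach: balanced truncation of `(A, B, C)` for the controlled part, and any
    -- asymptotically stable reduced model `(Ar, Cr, W)` for the uncontrolled part
    (∀ (n k : ℕ) (σ : Fin N → ℝ) (Vu Wu : Matrix (Fin N) (Fin k) ℝ)
        (Ar : Matrix (Fin n) (Fin n) ℝ) (Cr : Matrix (Fin p) (Fin n) ℝ)
        (W : Matrix (Fin N) (Fin n) ℝ),
      IsBalancedTruncation A B C σ Vu Wu →
      IsHurwitz Ar →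
      ∀ (Qm : Matrix (Fin N) (Fin n) ℝ) (Qr : Matrix (Fin n) (Fin n) ℝ),
      Aᵀ * Qm + Qm * Ar = Cᵀ * Cr →
      IsObservabilityGramian Ar Cr Qr →
      ∀ (zr : ℝ → Fin n → ℝ) (xu : ℝ → Fin k → ℝ),
      IsSolution Ar 0 (Wᵀ *ᵥ x₀) zr →
      IsSolution (Wuᵀ * A * Vu) (forcing (Wuᵀ * B) u) 0 xu →
        SquareIntegrable (output C x - (output Cr zr + output (C * Vu) xu)) ∧
        l2Norm (output C x - (output Cr zr + output (C * Vu) xu)) ≤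
          truncationBound σ k * l2Norm u + errorEstimator U Qm Qr W x₀) := by
  -- `xh` is the free response, so `x - xh` is the forced response from zero.
  obtain ⟨xh, hxh⟩ := exists_isSolution A (f := 0) (fun _ _ => IntervalIntegrable.zero) x₀
  have hxc : IsSolution A (forcing B u) 0 (x - xh) := by
    simpa using hx.sub (hu.intervalIntegrable_forcing B) (fun _ _ => IntervalIntegrable.zero) hxh
  constructor
  · intro N₀ n X₀ σ V W hVW hAr Qm Qr hQm hQr xr hxr
    obtain ⟨zr, hzr⟩ := exists_isSolution (Wᵀ * A * V) (f := 0)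
      (fun _ _ => IntervalIntegrable.zero) (Wᵀ *ᵥ x₀)
    have hxrc : IsSolution (Wᵀ * A * V) (forcing (Wᵀ * B) u) 0 (xr - zr) := by
      simpa using hxr.sub (hu.intervalIntegrable_forcing _) (fun _ _ => IntervalIntegrable.zero) hzr
    -- The padded input drives `[B, X₀]` exactly as `u` drives `B`, with the same `L²` norm.
    have hc := hVW.l2Norm_output_sub_le hA hu.extendInput (x := x - xh) (xr := xr - zr)
      (by rwa [forcing_fromCols_extendInput])
      (by rwa [mul_fromCols, forcing_fromCols_extendInput])
    rw [l2Norm_extendInput] at hc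
    have hh := (hA.output_sub_autonomous hAr hQ hQm hQr hxh hzr).2
    rw [← errorEstimator_eq hU] at hh
    have := l2Norm_add_le_of_le hc hh
    rwa [output_sub, output_sub, sub_sub_sub_comm, sub_add_cancel] at this
  · intro n k σ Vu Wu Ar Cr W hVW hAr Qm Qr hQm hQr zr xu hzr hxu
    have hc := hVW.l2Norm_output_sub_le hA hu hxc hxu
    have hh := (hA.output_sub_autonomous hAr hQ hQm hQr hxh hzr).2
    rw [← errorEstimator_eq hU] at hh
    have := l2Norm_add_le_of_le hc hh
    have hsum : output C x - (output Cr zr + output (C * Vu) xu)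
        = output C (x - xh) - output (C * Vu) xu + (output C xh - output Cr zr) := by
      rw [output_sub]
      abel
    rwa [hsum]
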